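/- Let $(V,g)$ be a real vector space of dimension $2n\ge 4$ with a positive definite inner product, and let $\mathcal T=\{K\in \mathrm{End}\,V : K^2=-\mathbb 1,\ g(K\cdot,K\cdot)=g(\cdot,\cdot)\}$ be its twistor space, a submanifold of $\mathrm{End}\,V$ with tangent spaces $T_K\mathcal T=\{A\in\mathfrak o(V,g) : AK+KA=0\}$. Let $\phi$ be the tautological section $\phi|_K=K$ of the trivial bundle $\mathrm{End}\,V\times\mathcal T$, fix $J\in\mathcal T$, regarded also as a constant section, and write $\{J,\phi\}=J\phi+\phi J$ and $[J,\phi]=J\phi-\phi J$. A *skew algebroid* $(E,[\cdot,\cdot],\psi)$ on $\mathcal T$ is a smooth vector bundle $E$ over $\mathcal T$ with an $\mathbb R$-bilinear skew-symmetric bracket on the space $\Gamma(E)$ of smooth sections and a smooth bundle map $\psi:E\to T\mathcal T$ such that, for all $A,B\in\Gamma(E)$ and $f\in C^\infty(\mathcal T)$, $$\psi([A,B])=[\psi(A),\psi(B)]_{\mathrm{Lie}},\qquad [A,fB]=f[A,B]+\psi(A)[f]\,B.$$ Let $S\in\{\mathbb 1,\ J+\phi,\ J-\phi,\ [J,\phi]\}$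 and $E=\mathfrak u(\mathbb V,J)$, the bundle over $\mathcal T$ with constant fibre $\{A\in\mathfrak o(V,g): JA=AJ\}$. Let $\tilde\gamma,\tilde\delta$ be the unique elements of $\{\pm J,\pm\phi\}$ such that $JS=S\tilde\gamma$ and $SJ=\tilde\delta S$, as sections over $\mathcal T$, and let $E^S$ be the bundle with fibre $\{B\in\mathfrak o(V,g):\tilde\gamma|_K B=B\,\tilde\delta|_K\}$ at $K\in\mathcal T$. Define functions $f_1,\dots,f_{2n}$ on $\mathcal T$ by $$\det(\lambda\mathbb 1-\{J,\phi\})=\lambda^{2n}-f_1\lambda^{2n-1}+\dots-f_{2n-1}\lambda+f_{2n}.$$ Let $Q=a_k\{J,\phi\}^k+\dots+a_1\{J,\phi\}+a_0\mathbb 1$ with each $a_i\in\mathbb R[f_1,\dots,f_{2n}]$, put $F=QS$, and define $\psi$ on $E^S$ by $\psi(A)=[FAF,\phi]$. Then there exists a bracket $[\cdot,\cdot]_F$ on $\Gamma(E^S)$ such that $(E^S,[\cdot,\cdot]_F,\psi)$ is a skew algebroid on $\mathcal T$. -/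

import Mathlib

open Module Filter
open scoped ContDiff Topology InnerProductSpace

namespace TwistorSpace

/-! Throughout, the metric `g` on `V` is the inner product of `V`, and `End V` is the normed algebra
`V →L[ℝ] V` (every endomorphism of a finite-dimensional space is continuous). -/

/-- The twistor space `𝒯(V,g)`, as a subset of the vector space `End V`. -/
def twistorSet (V : Type*) [NormedAddCommGroup V] [InnerProductSpace ℝ V] : Set (V →L[ℝ] V) :=
  {K | K * K = -1 ∧ ∀ x y : V, ⟪K x, K y⟫_ℝ = ⟪x, y⟫_ℝ}

/-- The points of the twistor space. -/
abbrev Twistor (V : Type*) [NormedAddCommGroup V] [InnerProductSpace ℝ V] : Type _ :=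
  ↥(twistorSet V)

section

variable {V : Type*} [NormedAddCommGroup V] [InnerProductSpace ℝ V]
  {F : Type*} [NormedAddCommGroup F] [NormedSpace ℝ F]

/-- Extension by zero to `End V` of a map that is defined on the twistor space. Only its values on
the twistor space are ever used. -/
noncomputable def ext (s : Twistor V → F) : (V →L[ℝ] V) → F :=
  Function.extend Subtype.val s 0

/-- A map on the twistor space, viewed as a submanifold of `End V`, is smooth. (Near each point the
twistor space is a smooth retract of an open subset of `End V`; so this says that the map is locally
the restriction of a smooth map on an open subset of `End V`.) -/
def IsSmooth (s : Twistor V → F) : Prop := ContDiffOn ℝ ∞ (ext s) (twistorSet V)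

/-- The derivative `ds_X` at `K` of a map on the twistor space, in the direction of a vector `X`
tangent to the twistor space at `K`. (Two derivatives of `s` within the twistor space agree on the
vectors tangent to it, so this does not depend on choices for such `X`.) -/
noncomputable def dAlong (s : Twistor V → F) (K : Twistor V) (X : V →L[ℝ] V) : F :=
  fderivWithin ℝ (ext s) (twistorSet V) K X

/-- The Lie bracket `[X,Y] = dY_X - dX_Y` of vector fields on the twistor space. -/
noncomputable def lieBracket (X Y : Twistor V → (V →L[ℝ] V)) : Twistor V → (V →L[ℝ] V) :=
  fun K => dAlong Y K (X K) - dAlong X K (Y K)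

theorem ext_apply (s : Twistor V → F) (K : Twistor V) : ext s K = s K :=
  Subtype.val_injective.extend_apply _ _ _

theorem isSmooth_congr {s : Twistor V → F} {h : (V →L[ℝ] V) → F}
    (hh : ContDiffOn ℝ ∞ h (twistorSet V)) (e : ∀ K : Twistor V, s K = h K) : IsSmooth s :=
  hh.congr fun K hK => (ext_apply s ⟨K, hK⟩).trans (e ⟨K, hK⟩)

theorem IsSmooth.add {s t : Twistor V → F} (hs : IsSmooth s) (ht : IsSmooth t) :
    IsSmooth (s + t) :=
  isSmooth_congr (ContDiffOn.add hs ht) fun K => by simp [ext_apply]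

theorem IsSmooth.smul {f : Twistor V → ℝ} {s : Twistor V → F} (hf : IsSmooth f)
    (hs : IsSmooth s) : IsSmooth (f • s) :=
  isSmooth_congr (ContDiffOn.smul hf hs) fun K => by simp [ext_apply]

theorem isSmooth_const (c : F) : IsSmooth (V := V) fun _ => c :=
  isSmooth_congr (contDiffOn_const (c := c)) fun _ => rfl

/-- The algebra `C^∞(𝒯)` of smooth real functions on the twistor space. -/
def smoothFun (V : Type*) [NormedAddCommGroup V] [InnerProductSpace ℝ V] :
    Subalgebra ℝ (Twistor V → ℝ) where
  carrier := {f | IsSmooth f}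
  mul_mem' hf hg := IsSmooth.smul hf hg
  add_mem' hf hg := IsSmooth.add hf hg
  algebraMap_mem' c := isSmooth_const c

/-- The Lie algebra `𝔬(V,g)` of skew endomorphisms. -/
def orth (V : Type*) [NormedAddCommGroup V] [InnerProductSpace ℝ V] :
    Submodule ℝ (V →L[ℝ] V) where
  carrier := {A | ∀ x y : V, ⟪A x, y⟫_ℝ = -⟪x, A y⟫_ℝ}
  add_mem' hA hB x y := by
    simp only [_root_.add_apply, inner_add_left, inner_add_right, hA x y, hB x y]
    ring
  zero_mem' x y := by simp
  smul_mem' c A hA x y := by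
    simp only [_root_.smul_apply, real_inner_smul_left, real_inner_smul_right, hA x y]
    ring

/-- The tangent space `T_K 𝒯 = {A ∈ 𝔬(V,g) | AK + KA = 0}`. -/
def tangent (K : Twistor V) : Submodule ℝ (V →L[ℝ] V) where
  carrier := {A | A ∈ orth V ∧ A * (K : V →L[ℝ] V) + K * A = 0}
  add_mem' {A B} hA hB := ⟨add_mem hA.1 hB.1, by
    rw [add_mul, mul_add, add_add_add_comm, hA.2, hB.2, add_zero]⟩
  zero_mem' := ⟨zero_mem _, by simp⟩
  smul_mem' c A hA := ⟨Submodule.smul_mem _ c hA.1, by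
    rw [smul_mul_assoc, mul_smul_comm, ← smul_add, hA.2, smul_zero]⟩

/-- The space `Γ(E)` of smooth sections of a family `E` of linear subspaces of `End V` that is
indexed by the twistor space. -/
def Sections (E : Twistor V → Submodule ℝ (V →L[ℝ] V)) :
    Submodule ℝ (Twistor V → (V →L[ℝ] V)) where
  carrier := {s | IsSmooth s ∧ ∀ K, s K ∈ E K}
  add_mem' hs ht := ⟨hs.1.add ht.1, fun K => add_mem (hs.2 K) (ht.2 K)⟩
  zero_mem' := ⟨isSmooth_const 0, fun _ => zero_mem _⟩
  smul_mem' c _ hs := ⟨(isSmooth_const c).smul hs.1, fun K => (E K).smul_mem c (hs.2 K)⟩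

/-- The product of a smooth function and a section. -/
instance (E : Twistor V → Submodule ℝ (V →L[ℝ] V)) : SMul (smoothFun V) (Sections E) where
  smul f B := ⟨fun K => f.1 K • B.1 K,
    IsSmooth.smul f.2 B.2.1, fun K => (E K).smul_mem (f.1 K) (B.2.2 K)⟩

/-- The family `E` is a smooth vector subbundle of the trivial bundle `End V × 𝒯`: near each point
there is a frame of smooth sections. -/
def IsVectorBundle (E : Twistor V → Submodule ℝ (V →L[ℝ] V)) : Prop :=
  ∀ K : Twistor V, ∃ (r : ℕ) (s : Fin r → Sections E), ∀ᶠ L in 𝓝 K,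
    LinearIndependent ℝ (fun i => (s i).1 L) ∧
      Submodule.span ℝ (Set.range fun i => (s i).1 L) = E L

/-- `(E, [·,·], ψ)` is a skew algebroid on the twistor space, where `[·,·]` is an `ℝ`-bilinear
bracket on `Γ(E)` and where `ψ` is given on the fibre `E K` by a linear map `ψ K`. -/
structure IsSkewAlgebroid (E : Twistor V → Submodule ℝ (V →L[ℝ] V))
    (br : Sections E →ₗ[ℝ] Sections E →ₗ[ℝ] Sections E)
    (ψ : Twistor V → (V →L[ℝ] V) →ₗ[ℝ] (V →L[ℝ] V)) : Prop where
  isVectorBundle : IsVectorBundle E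
  /-- `ψ` maps `E` to the tangent bundle. -/
  anchor_mem : ∀ K, ∀ A ∈ E K, ψ K A ∈ tangent K
  /-- `ψ` is smooth. -/
  anchor_smooth : ∀ A : Sections E, IsSmooth fun K => ψ K (A.1 K)
  skew : ∀ A B, br A B = -br B A
  anchor_bracket : ∀ A B : Sections E,
    (fun K => ψ K ((br A B).1 K)) = lieBracket (fun K => ψ K (A.1 K)) (fun K => ψ K (B.1 K))
  leibniz : ∀ (A B : Sections E) (f : smoothFun V),
    (br A (f • B)).1 = fun K => f.1 K • (br A B).1 K + dAlong f.1 K (ψ K (A.1 K)) • B.1 K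

/-- The tautological section `φ`, with `φ|_K = K`. -/
def φ : Twistor V → (V →L[ℝ] V) := fun K => K

/-- The constant section `J`. -/
def cst (J : Twistor V) : Twistor V → (V →L[ℝ] V) := fun _ => J

/-- The set `{1, J + φ, J - φ, [J,φ]}` of sections of `End V × 𝒯`. -/
def sSet (J : Twistor V) : Set (Twistor V → (V →L[ℝ] V)) :=
  {1, cst J + φ, cst J - φ, cst J * φ - φ * cst J}

/-- The set `{J, -J, φ, -φ}` of sections of `End V × 𝒯`. -/
def letters (J : Twistor V) : Set (Twistor V → (V →L[ℝ] V)) :=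
  {cst J, -cst J, φ, -φ}

/-- The bundle `E = {A ∈ 𝔬(V,g) | γ A = A δ}`. In particular, `𝔲(V,J)` is `bundle (cst J) (cst J)`. -/
def bundle (γ δ : Twistor V → (V →L[ℝ] V)) (K : Twistor V) : Submodule ℝ (V →L[ℝ] V) where
  carrier := {A | A ∈ orth V ∧ γ K * A = A * δ K}
  add_mem' {A B} hA hB := ⟨add_mem hA.1 hB.1, by rw [mul_add, add_mul, hA.2, hB.2]⟩
  zero_mem' := ⟨zero_mem _, by simp⟩
  smul_mem' c A hA := ⟨Submodule.smul_mem _ c hA.1, by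
    rw [mul_smul_comm, smul_mul_assoc, hA.2]⟩

/-- The bundle `E^S` of `E = bundle γ δ`: it is `bundle γ' δ'` for the elements `γ'`, `δ'` of
`{J, -J, φ, -φ}` with `γ S = S γ'` and `S δ = δ' S`. When `dim V ≥ 4`, these exist and are unique,
see `existsUnique_left` and `existsUnique_right` below. -/
def bundleS (J : Twistor V) (S γ δ : Twistor V → (V →L[ℝ] V)) (K : Twistor V) :
    Submodule ℝ (V →L[ℝ] V) :=
  ⨅ (γ' ∈ letters J) (δ' ∈ letters J) (_ : γ * S = S * γ') (_ : S * δ = δ' * S), bundle γ' δ' K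

/-- The section `{J,φ} = Jφ + φJ`. -/
def anti (J : Twistor V) : Twistor V → (V →L[ℝ] V) := cst J * φ + φ * cst J

/-- The functions `f_j` on the twistor space with
`det(λ1 - {J,φ}) = λ^{2n} - f_1 λ^{2n-1} + ... - f_{2n-1} λ + f_{2n}`, where `dim V = 2n`. -/
noncomputable def symFun [FiniteDimensional ℝ V] (J : Twistor V) (n j : ℕ) : Twistor V → ℝ := fun K =>
  (-1) ^ j * (LinearMap.charpoly (anti J K : V →ₗ[ℝ] V)).coeff (2 * n - j)

/-- The section `Q = a_k {J,φ}^k + ... + a_1 {J,φ} + a_0 1`. -/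
noncomputable def polyQ (J : Twistor V) (k : ℕ) (a : ℕ → Twistor V → ℝ) :
    Twistor V → (V →L[ℝ] V) :=
  fun K => ∑ i ∈ Finset.range (k + 1), a i K • anti J K ^ i

/-- The map `ψ`, given at `K` by `A ↦ [F A F, φ]`. -/
noncomputable def anchor (F : Twistor V → (V →L[ℝ] V)) (K : Twistor V) :
    (V →L[ℝ] V) →ₗ[ℝ] (V →L[ℝ] V) where
  toFun A := F K * A * F K * φ K - φ K * (F K * A * F K)
  map_add' A B := by simp only [mul_add, add_mul]; abel
  map_smul' c A := by simp [smul_sub]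

/-! The elements `γ'` and `δ'` in the definition of `E^S` exist and are unique. -/

theorem sq_eq (K : Twistor V) : (K : V →L[ℝ] V) * K = -1 := K.2.1

theorem mem_orth (K : Twistor V) : (K : V →L[ℝ] V) ∈ orth V := fun x y => by
  rw [← K.2.2 x, ← mul_apply_eq_comp, K.2.1]
  simp

theorem exists_tilde (J : Twistor V) {S γ : Twistor V → (V →L[ℝ] V)} (hS : S ∈ sSet J)
    (hγ : γ ∈ letters J) : ∃ γ' ∈ letters J, γ * S = S * γ' ∧ S * γ = γ' * S := by
  have h1 : cst J * cst J = -1 := funext fun _ => sq_eq J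
  have h2 : (φ : Twistor V → (V →L[ℝ] V)) * φ = -1 := funext fun K => sq_eq K
  have h3 : ∀ x, cst J * (cst J * x) = -x := fun x => by rw [← mul_assoc, h1, neg_one_mul]
  have h4 : ∀ x : Twistor V → (V →L[ℝ] V), φ * (φ * x) = -x := fun x => by
    rw [← mul_assoc, h2, neg_one_mul]
  simp only [sSet, letters, Set.mem_insert_iff, Set.mem_singleton_iff] at hS hγ
  have key : ∀ c : Twistor V → (V →L[ℝ] V), c = cst J ∨ c = φ →
      ∃ γ' ∈ letters J, -γ' ∈ letters J ∧ c * S = S * γ' ∧ S * c = γ' * S := by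
    have m1 : cst J ∈ letters J := by simp [letters]
    have m2 : -cst J ∈ letters J := by simp [letters]
    have m3 : φ ∈ letters J := by simp [letters]
    have m4 : -φ ∈ letters J := by simp [letters]
    have m5 : - -cst J ∈ letters J := by simp [letters]
    have m6 : - -φ ∈ letters J := by simp [letters]
    rintro c (rfl | rfl) <;> rcases hS with rfl | rfl | rfl | rfl
    · exact ⟨_, m1, m2, by simp, by simp⟩
    · exact ⟨_, m3, m4, by simp only [mul_add, add_mul, h1, h2]; abel,
        by simp only [mul_add, add_mul, h1, h2]; abel⟩
    · exact ⟨_, m4, m6, by simp only [mul_sub, sub_mul, h1, h2, mul_neg, neg_mul]; abel,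
        by simp only [mul_sub, sub_mul, h1, h2, mul_neg, neg_mul]; abel⟩
    · exact ⟨_, m2, m5,
        by simp only [mul_sub, sub_mul, h1, h2, h3, mul_neg, neg_mul, mul_assoc, mul_one]; abel,
        by simp only [mul_sub, sub_mul, h1, h2, h3, mul_neg, neg_mul, mul_assoc, mul_one]; abel⟩
    · exact ⟨_, m3, m4, by simp, by simp⟩
    · exact ⟨_, m1, m2, by simp only [mul_add, add_mul, h1, h2]; abel,
        by simp only [mul_add, add_mul, h1, h2]; abel⟩
    · exact ⟨_, m2, m5, by simp only [mul_sub, sub_mul, h1, h2, mul_neg, neg_mul]; abel,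
        by simp only [mul_sub, sub_mul, h1, h2, mul_neg, neg_mul]; abel⟩
    · exact ⟨_, m4, m6,
        by simp only [mul_sub, sub_mul, h1, h2, h4, mul_neg, neg_mul, mul_assoc, mul_one]; abel,
        by simp only [mul_sub, sub_mul, h1, h2, h4, mul_neg, neg_mul, mul_assoc, mul_one]; abel⟩
  rcases hγ with rfl | rfl | rfl | rfl
  · obtain ⟨x, hx, -, hy, hz⟩ := key _ (Or.inl rfl)
    exact ⟨x, hx, hy, hz⟩
  · obtain ⟨x, -, hx, hy, hz⟩ := key _ (Or.inl rfl)
    exact ⟨-x, hx, by rw [neg_mul, mul_neg, hy], by rw [neg_mul, mul_neg, hz]⟩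
  · obtain ⟨x, hx, -, hy, hz⟩ := key _ (Or.inr rfl)
    exact ⟨x, hx, hy, hz⟩
  · obtain ⟨x, -, hx, hy, hz⟩ := key _ (Or.inr rfl)
    exact ⟨-x, hx, by rw [neg_mul, mul_neg, hy], by rw [neg_mul, mul_neg, hz]⟩

theorem conj_mem (K : Twistor V) (R : V ≃ₗᵢ[ℝ] V) :
    (R : V →L[ℝ] V) * K * (R.symm : V →L[ℝ] V) ∈ twistorSet V := by
  refine ⟨?_, fun x y => ?_⟩
  · ext x
    have h : ∀ y, (K : V →L[ℝ] V) ((K : V →L[ℝ] V) y) = -y := fun y =>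
      DFunLike.congr_fun K.2.1 y
    simp [h]
  · have h := K.2.2 (R.symm x) (R.symm y)
    simpa using h

theorem exists_comm_ne (hdim : 4 ≤ finrank ℝ V) (J : Twistor V) :
    ∃ K : Twistor V, (J : V →L[ℝ] V) * K - K * J ≠ 0 := by
  have : FiniteDimensional ℝ V := FiniteDimensional.of_finrank_pos (by omega)
  have : Nontrivial V := Module.nontrivial_of_finrank_pos (R := ℝ) (by omega)
  have hsk := mem_orth J
  have hsq : ∀ y, (J : V →L[ℝ] V) ((J : V →L[ℝ] V) y) = -y := fun y => DFunLike.congr_fun J.2.1 y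
  set j : V →L[ℝ] V := J.1 with hj
  have hself : ∀ x, ⟪x, j x⟫_ℝ = 0 := fun x => by
    have h1 := hsk x x
    rw [real_inner_comm] at h1
    linarith
  obtain ⟨e, he⟩ := exists_norm_eq V (zero_le_one' ℝ)
  classical
  obtain ⟨f, hf, hef, hjf⟩ : ∃ f : V, ‖f‖ = 1 ∧ ⟪e, f⟫_ℝ = 0 ∧ ⟪j e, f⟫_ℝ = 0 := by
    let W : Submodule ℝ V := Submodule.span ℝ (({e, j e} : Finset V) : Set V)
    have hW : finrank ℝ W ≤ 2 := (finrank_span_finset_le_card _).trans Finset.card_le_two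
    have hsum := W.finrank_add_finrank_orthogonal
    have : Nontrivial Wᗮ := Module.nontrivial_of_finrank_pos (R := ℝ) (by omega)
    obtain ⟨f, hf⟩ := exists_norm_eq Wᗮ (zero_le_one' ℝ)
    have hm := W.mem_orthogonal (f : V) |>.1 f.2
    exact ⟨f, by simpa using hf, hm e (Submodule.subset_span (by simp)),
      hm (j e) (Submodule.subset_span (by simp))⟩
  have hejf : ⟪e, j f⟫_ℝ = 0 := by have := hsk e f; linarith
  have hperp : ∀ u v : V, ⟪u, v⟫_ℝ = 0 → (ℝ ∙ u)ᗮ.reflection v = v := fun u v h =>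
    Submodule.reflection_mem_subspace_eq_self (Submodule.mem_orthogonal_singleton_iff_inner_right.2 h)
  let a := (ℝ ∙ e)ᗮ.reflection
  let b := (ℝ ∙ (e - -f))ᗮ.reflection
  have ae : a e = -e := Submodule.reflection_orthogonalComplement_singleton_eq_neg e
  have af : a f = f := hperp _ _ hef
  have aje : a (j e) = j e := hperp _ _ (hself e)
  have ajf : a (j f) = j f := hperp _ _ hejf
  have be : b e = -f := Submodule.reflection_sub (by rw [norm_neg, he, hf])
  have bf : b f = -e := by
    have h : b (b e) = e := Submodule.reflection_reflection _ e
    rw [be, map_neg] at h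
    rw [← h, neg_neg]
  have bje : b (j e) = j e := hperp _ _ (by
    rw [sub_neg_eq_add, inner_add_left, hself, real_inner_comm, hjf, add_zero])
  have bjf : b (j f) = j f := hperp _ _ (by
    rw [sub_neg_eq_add, inner_add_left, hself, hejf, add_zero])
  refine ⟨⟨_, conj_mem J (b.trans a)⟩, fun h => ?_⟩
  have asymm : a.symm = a := Submodule.reflection_symm
  have bsymm : b.symm = b := Submodule.reflection_symm
  have h2 := DFunLike.congr_fun h e
  have ke : (((b.trans a : V ≃ₗᵢ[ℝ] V) : V →L[ℝ] V) * j *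
      ((b.trans a).symm : V →L[ℝ] V)) e = j f := by
    change a (b (j (b.symm (a.symm e)))) = j f
    rw [asymm, bsymm, ae, map_neg, be, neg_neg, bjf, ajf]
  have kje : (((b.trans a : V ≃ₗᵢ[ℝ] V) : V →L[ℝ] V) * j *
      ((b.trans a).symm : V →L[ℝ] V)) (j e) = f := by
    change a (b (j (b.symm (a.symm (j e))))) = f
    rw [asymm, bsymm, aje, bje, hsq, map_neg, be, neg_neg, af]
  have h3 : j (j f) - f = 0 := by
    refine Eq.trans ?_ h2
    change _ = j _ - _
    congr 1
    · exact congr_arg j ke.symm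
    · exact kje.symm
  rw [hsq] at h3
  have h4 : (2 : ℝ) • f = 0 := by rw [two_smul]; rw [← neg_eq_zero, ← h3]; abel
  have h5 : f = 0 := (smul_eq_zero.1 h4).resolve_left two_ne_zero
  rw [h5, norm_zero] at hf
  exact zero_ne_one hf

theorem eq_zero_of_mul_self {A : V →L[ℝ] V} (hA : A ∈ orth V) (h : A * A = 0) : A = 0 := by
  ext x
  have h1 := hA x (A x)
  have h2 : A (A x) = 0 := DFunLike.congr_fun h x
  rw [h2, inner_zero_right, neg_zero] at h1
  exact inner_self_eq_zero.1 h1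

theorem comm_mem_orth (J K : Twistor V) : (J : V →L[ℝ] V) * K - K * J ∈ orth V := fun x y => by
  simp only [sub_apply, mul_apply_eq_comp, inner_sub_left, inner_sub_right,
    mem_orth J _ y, mem_orth K _ y, mem_orth J x, mem_orth K x]
  ring

theorem exists_factor (J K : Twistor V) {S : Twistor V → (V →L[ℝ] V)} (hS : S ∈ sSet J) :
    ∃ T T' : V →L[ℝ] V, T * S K = (J : V →L[ℝ] V) * K - K * J ∧
      S K * T' = (J : V →L[ℝ] V) * K - K * J := by
  have hj := sq_eq J
  have hk := sq_eq K
  simp only [sSet, Set.mem_insert_iff, Set.mem_singleton_iff] at hS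
  rcases hS with rfl | rfl | rfl | rfl
  · exact ⟨_, _, mul_one _, one_mul _⟩
  · refine ⟨J - K, K - J, ?_, ?_⟩ <;>
      simp only [cst, φ, Pi.add_apply, mul_add, add_mul, mul_sub, sub_mul, hj, hk] <;> abel
  · refine ⟨-(J + K), J + K, ?_, ?_⟩ <;>
      simp only [cst, φ, Pi.sub_apply, mul_add, add_mul, mul_sub, sub_mul, neg_mul, hj, hk] <;> abel
  · exact ⟨1, 1, one_mul _, mul_one _⟩

/-- Different elements of `{J, -J, φ, -φ}` stay different after composition with `S`. -/
theorem eq_of_mul (hdim : 4 ≤ finrank ℝ V) (J : Twistor V) {S γ δ : Twistor V → (V →L[ℝ] V)}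
    (hS : S ∈ sSet J) (hγ : γ ∈ letters J) (hδ : δ ∈ letters J)
    (h : S * γ = S * δ ∨ γ * S = δ * S) : γ = δ := by
  obtain ⟨K, hK⟩ := exists_comm_ne hdim J
  obtain ⟨T, T', hT, hT'⟩ := exists_factor J K hS
  have hcc := fun h => hK (eq_zero_of_mul_self (comm_mem_orth J K) h)
  have hj := sq_eq J
  have hk := sq_eq K
  have sq : ∀ x ∈ letters J, x K * x K = -1 := fun x hx => by
    simp only [letters, Set.mem_insert_iff, Set.mem_singleton_iff] at hx
    rcases hx with rfl | rfl | rfl | rfl <;> simp [cst, φ, hj, hk]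
  set c : V →L[ℝ] V := (J : V →L[ℝ] V) * K - K * J with hc
  have hcD : c * (γ K - δ K) = 0 ∨ (γ K - δ K) * c = 0 := by
    rcases h with h | h
    · left
      have := congr_fun h K
      simp only [Pi.mul_apply] at this
      rw [← hT, mul_assoc, mul_sub, this, sub_self, mul_zero]
    · right
      have := congr_fun h K
      simp only [Pi.mul_apply] at this
      rw [← hT', ← mul_assoc, sub_mul, this, sub_self, zero_mul]
  have opp : γ ≠ -δ := fun h => hK <| by
    have h2 : γ K = -δ K := congr_fun h K
    have h3 : (γ K - δ K) * δ K = (2 : ℝ) • 1 := by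
      rw [h2, sub_mul, neg_mul, sq δ hδ, two_smul]; abel
    have h4 : δ K * (γ K - δ K) = (2 : ℝ) • 1 := by
      rw [h2, mul_sub, mul_neg, sq δ hδ, two_smul]; abel
    have h5 : (2 : ℝ) • c = 0 := by
      rcases hcD with h | h
      · rw [← mul_one c, ← mul_smul_comm, ← h3, ← mul_assoc, h, zero_mul]
      · rw [← one_mul c, ← smul_mul_assoc, ← h4, mul_assoc, h, mul_zero]
    exact (smul_eq_zero.1 h5).resolve_left two_ne_zero
  have comm : γ K * δ K - δ K * γ K ≠ c ∧ γ K * δ K - δ K * γ K ≠ -c := by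
    have h3 : (γ K - δ K) * (γ K + δ K) = γ K * δ K - δ K * γ K := by
      rw [sub_mul, mul_add, mul_add, sq γ hγ, sq δ hδ]; abel
    have h4 : (γ K + δ K) * (γ K - δ K) = -(γ K * δ K - δ K * γ K) := by
      rw [add_mul, mul_sub, mul_sub, sq γ hγ, sq δ hδ]; abel
    have h5 : c * (γ K * δ K - δ K * γ K) = 0 ∨ (γ K * δ K - δ K * γ K) * c = 0 := by
      rcases hcD with h | h
      · left; rw [← h3, ← mul_assoc, h, zero_mul]
      · right; rw [← neg_eq_zero, ← neg_mul, ← h4, mul_assoc, h, mul_zero]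
    constructor <;> intro h <;> rw [h] at h5 <;> apply hcc <;> simpa using h5
  simp only [letters, Set.mem_insert_iff, Set.mem_singleton_iff] at hγ hδ
  rcases hγ with rfl | rfl | rfl | rfl <;> rcases hδ with rfl | rfl | rfl | rfl <;>
    first
    | rfl
    | (refine absurd ?_ opp; simp; done)
    | (refine absurd ?_ comm.1
       simp only [cst, φ, Pi.neg_apply, neg_mul, mul_neg, neg_neg, hc]; done)
    | (refine absurd ?_ comm.1
       simp only [cst, φ, Pi.neg_apply, neg_mul, mul_neg, neg_neg, hc]; abel1)
    | (refine absurd ?_ comm.2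
       simp only [cst, φ, Pi.neg_apply, neg_mul, mul_neg, neg_neg, hc]; abel1)

theorem existsUnique_left (hdim : 4 ≤ finrank ℝ V) (J : Twistor V)
    {S γ : Twistor V → (V →L[ℝ] V)} (hS : S ∈ sSet J) (hγ : γ ∈ letters J) :
    ∃! γ', γ' ∈ letters J ∧ γ * S = S * γ' := by
  obtain ⟨γ', h, h1, -⟩ := exists_tilde J hS hγ
  exact ⟨γ', ⟨h, h1⟩, fun δ hδ => eq_of_mul hdim J hS hδ.1 h (Or.inl (hδ.2.symm.trans h1))⟩

theorem existsUnique_right (hdim : 4 ≤ finrank ℝ V) (J : Twistor V)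
    {S δ : Twistor V → (V →L[ℝ] V)} (hS : S ∈ sSet J) (hδ : δ ∈ letters J) :
    ∃! δ', δ' ∈ letters J ∧ S * δ = δ' * S := by
  obtain ⟨γ', h, -, h1⟩ := exists_tilde J hS hδ
  exact ⟨γ', ⟨h, h1⟩, fun δ hδ => eq_of_mul hdim J hS hδ.1 h (Or.inr (hδ.2.symm.trans h1))⟩

end

end TwistorSpace

open TwistorSpace

/-!
For a section `A` of `E^S` put `X_A = FAF`. It is skew and commutes with `J`, and the vector
`ψ(A) = [X_A, φ]` generates the conjugation by `exp (t X_A)`. For skew `X` commuting with `J`, the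
Lie derivative `D_X s = ds_[X,φ] - [X, s]` of sections of `End V × 𝒯` is a derivation that kills
the sections equivariant under the isometries fixing `J`, such as `φ`, `F` and `γ̃ = δ̃`. So
`∇_A B = D_{X_A} B` is again a section of `E^S`, and differentiating `ψ(B)` along `ψ(A)` gives
`ψ(∇_A B) + [X_A, [X_B, φ]]`. Since `[X_A, X_B] = F(AF²B - BF²A)F`, the Jacobi identity shows that
`[A, B] = ∇_A B - ∇_B A + (AF²B - BF²A)` satisfies `ψ([A, B]) = [ψ(A), ψ(B)]`.
-/

namespace TwistorSpace

section Skew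

variable {V : Type*} [NormedAddCommGroup V] [InnerProductSpace ℝ V]

theorem neg_mem_twistorSet {K : V →L[ℝ] V} (hK : K ∈ twistorSet V) : -K ∈ twistorSet V :=
  ⟨by rw [neg_mul_neg, hK.1], fun x y => by simpa using hK.2 x y⟩

variable [CompleteSpace V]

theorem mem_orth_iff_star {A : V →L[ℝ] V} : A ∈ orth V ↔ star A = -A := by
  rw [← neg_eq_iff_eq_neg, eq_comm, ← star_neg, ContinuousLinearMap.star_eq_adjoint,
    ContinuousLinearMap.eq_adjoint_iff]
  simp [orth]

theorem isClosed_orth : IsClosed (orth V : Set (V →L[ℝ] V)) := by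
  rw [show (orth V : Set (V →L[ℝ] V)) = {A | star A = -A} from Set.ext fun _ => mem_orth_iff_star]
  exact isClosed_eq continuous_star continuous_neg

theorem star_eq_neg_of_mem_twistorSet {K : V →L[ℝ] V} (hK : K ∈ twistorSet V) : star K = -K :=
  mem_orth_iff_star.1 (mem_orth ⟨K, hK⟩)

theorem lie_mem_orth {A B : V →L[ℝ] V} (hA : A ∈ orth V) (hB : B ∈ orth V) : ⁅A, B⁆ ∈ orth V := by
  rw [mem_orth_iff_star] at *
  rw [Ring.lie_def, star_sub, star_mul, star_mul, hA, hB]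
  noncomm_ring

theorem mul_mul_star_mem_orth {A : V →L[ℝ] V} (F : V →L[ℝ] V) (hA : A ∈ orth V) :
    F * A * star F ∈ orth V := by
  rw [mem_orth_iff_star] at *
  rw [star_mul, star_mul, star_star, hA]
  noncomm_ring

theorem lie_mem_tangent {X : V →L[ℝ] V} (hX : X ∈ orth V) (K : Twistor V) :
    ⁅X, (K : V →L[ℝ] V)⁆ ∈ tangent K := by
  refine ⟨lie_mem_orth hX (mem_orth K), ?_⟩
  rw [Ring.lie_def, sub_mul, mul_sub, mul_assoc X, sq_eq, ← mul_assoc (K : V →L[ℝ] V) K, sq_eq]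
  noncomm_ring

end Skew

section Isometry

variable {V : Type*} [NormedAddCommGroup V] [InnerProductSpace ℝ V]

/-- The action of an isometry of `V` on the twistor space by conjugation. -/
def conj (R : V ≃ₗᵢ[ℝ] V) (K : Twistor V) : Twistor V := ⟨_, conj_mem K R⟩

theorem coe_mul_coe_symm (R : V ≃ₗᵢ[ℝ] V) : (R : V →L[ℝ] V) * (R.symm : V →L[ℝ] V) = 1 := by
  ext; simp

theorem coe_symm_mul_coe (R : V ≃ₗᵢ[ℝ] V) : (R.symm : V →L[ℝ] V) * (R : V →L[ℝ] V) = 1 := by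
  ext; simp

variable [CompleteSpace V]

/-- The isometry `exp A` of `V`, for a skew endomorphism `A`. -/
noncomputable def expIsometry (A : orth V) : V ≃ₗᵢ[ℝ] V :=
  letI := NormedAlgebra.restrictScalars ℚ ℝ (V →L[ℝ] V)
  Unitary.linearIsometryEquiv ⟨NormedSpace.exp (A : V →L[ℝ] V),
    NormedSpace.exp_mem_unitary_of_mem_skewAdjoint (mem_orth_iff_star.1 A.2)⟩

theorem coe_expIsometry (A : orth V) :
    (expIsometry A : V →L[ℝ] V) = NormedSpace.exp (A : V →L[ℝ] V) := rfl

theorem coe_expIsometry_symm (A : orth V) :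
    ((expIsometry A).symm : V →L[ℝ] V) = star (expIsometry A : V →L[ℝ] V) := rfl

theorem expIsometry_zero : expIsometry (0 : orth V) = 1 := by
  ext x
  change NormedSpace.exp (0 : V →L[ℝ] V) x = x
  simp

theorem hasDerivAt_expIsometry (A : orth V) :
    HasDerivAt (fun t : ℝ => (expIsometry (t • A) : V →L[ℝ] V)) A 0 := by
  simpa [coe_expIsometry] using hasDerivAt_exp_smul_const (𝕂 := ℝ) (A : V →L[ℝ] V) 0

theorem hasDerivAt_expIsometry_symm (A : orth V) :
    HasDerivAt (fun t : ℝ => ((expIsometry (t • A)).symm : V →L[ℝ] V)) (-A) 0 := by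
  simpa only [coe_expIsometry_symm, mem_orth_iff_star.1 A.2] using (hasDerivAt_expIsometry A).star

theorem conj_expIsometry_eq_self {J : Twistor V} {A : orth V} (h : Commute (A : V →L[ℝ] V) J) :
    conj (expIsometry A) J = J := by
  have hcomm : Commute (NormedSpace.exp (A : V →L[ℝ] V)) J := h.exp_left
  ext1
  change (expIsometry A : V →L[ℝ] V) * J * ((expIsometry A).symm : V →L[ℝ] V) = J
  rw [coe_expIsometry, hcomm.eq, mul_assoc, ← coe_expIsometry, coe_mul_coe_symm, mul_one]

/-- The flow `K ↦ exp(tA) K exp(-tA)` on the twistor space, for a skew endomorphism `A`. -/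
noncomputable def flow (A : orth V) (t : ℝ) (K : Twistor V) : Twistor V :=
  conj (expIsometry (t • A)) K

theorem flow_zero (A : orth V) (K : Twistor V) : flow A 0 K = K := by
  ext1
  change (expIsometry ((0 : ℝ) • A) : V →L[ℝ] V) * K * (expIsometry ((0 : ℝ) • A)).symm = K
  rw [zero_smul, expIsometry_zero]
  rfl

theorem hasDerivAt_flow (A : orth V) (K : Twistor V) :
    HasDerivAt (fun t => (flow A t K : V →L[ℝ] V)) ⁅(A : V →L[ℝ] V), (K : V →L[ℝ] V)⁆ 0 := by
  have h := ((hasDerivAt_expIsometry A).mul_const (K : V →L[ℝ] V)).mul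
    (hasDerivAt_expIsometry_symm A)
  rw [zero_smul, expIsometry_zero] at h
  refine h.congr_deriv ?_
  change (A : V →L[ℝ] V) * K * 1 + 1 * K * -A = _
  rw [Ring.lie_def]
  noncomm_ring

end Isometry

section Calculus

variable {V : Type*} [NormedAddCommGroup V] [InnerProductSpace ℝ V]
  {F : Type*} [NormedAddCommGroup F] [NormedSpace ℝ F]

theorem IsSmooth.contDiff_comp {G : Type*} [NormedAddCommGroup G] [NormedSpace ℝ G] {g : F → G}
    {s : Twistor V → F} (hg : ContDiff ℝ ∞ g) (hs : IsSmooth s) : IsSmooth fun K => g (s K) :=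
  isSmooth_congr (hg.comp_contDiffOn hs) fun K => by rw [Function.comp_apply, ext_apply]

theorem IsSmooth.sub {s t : Twistor V → F} (hs : IsSmooth s) (ht : IsSmooth t) :
    IsSmooth (s - t) :=
  isSmooth_congr (ContDiffOn.sub hs ht) fun K => by simp [ext_apply]

theorem IsSmooth.mul {s t : Twistor V → (V →L[ℝ] V)} (hs : IsSmooth s) (ht : IsSmooth t) :
    IsSmooth (s * t) :=
  isSmooth_congr (ContDiffOn.mul hs ht) fun K => by simp [ext_apply]

theorem IsSmooth.clm_apply {G : Type*} [NormedAddCommGroup G] [NormedSpace ℝ G]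
    {P : Twistor V → F →L[ℝ] G} {s : Twistor V → F} (hP : IsSmooth P) (hs : IsSmooth s) :
    IsSmooth fun K => P K (s K) :=
  isSmooth_congr (ContDiffOn.clm_apply hP hs) fun K => by simp [ext_apply]

theorem IsSmooth.continuous {s : Twistor V → F} (hs : IsSmooth s) : Continuous s :=
  (continuousOn_iff_continuous_domRestrict.1 (ContDiffOn.continuousOn hs)).congr (ext_apply s)

theorem isSmooth_φ : IsSmooth (φ : Twistor V → (V →L[ℝ] V)) :=
  isSmooth_congr contDiffOn_id fun _ => rfl

variable [CompleteSpace V]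

theorem hasDerivAt_comp_flow {s : Twistor V → F} {K : Twistor V} {s' : (V →L[ℝ] V) →L[ℝ] F}
    (h : HasFDerivWithinAt (ext s) s' (twistorSet V) K) (A : orth V) :
    HasDerivAt (fun t => s (flow A t K)) (s' ⁅(A : V →L[ℝ] V), (K : V →L[ℝ] V)⁆) 0 := by
  have hcomp := h.comp_hasDerivAt_of_eq (0 : ℝ) (hasDerivAt_flow A K)
    (Eventually.of_forall fun t => (flow A t K).2) (by rw [flow_zero])
  exact hcomp.congr_of_eventuallyEq (Eventually.of_forall fun t => (ext_apply s (flow A t K)).symm)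

theorem IsSmooth.hasDerivAt_flow {s : Twistor V → F} (hs : IsSmooth s) (A : orth V)
    (K : Twistor V) :
    HasDerivAt (fun t => s (flow A t K)) (dAlong s K ⁅(A : V →L[ℝ] V), (K : V →L[ℝ] V)⁆) 0 :=
  hasDerivAt_comp_flow ((hs K K.2).differentiableWithinAt (by simp)).hasFDerivWithinAt A

-- `fderivWithin` is only determined on tangent vectors, so its smoothness is read off a local
-- smooth choice of derivatives, which agrees with it along the flows.
theorem IsSmooth.dAlong_lie {s X : Twistor V → (V →L[ℝ] V)} (hs : IsSmooth s) (hX : IsSmooth X)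
    (hXo : ∀ K, X K ∈ orth V) : IsSmooth fun K => dAlong s K ⁅X K, (K : V →L[ℝ] V)⁆ := by
  refine fun x hx => contDiffWithinAt_infty.2 fun m => ?_
  obtain ⟨u, hu, hut, -, s', hs', hs'_smooth⟩ :=
    (contDiffWithinAt_succ_iff_hasFDerivWithinAt' (by simp)).1
      ((hs x hx).of_le (by exact_mod_cast le_top : (m : WithTop ℕ∞) + 1 ≤ ∞))
  rw [Set.insert_eq_of_mem hx] at hu hut
  have hY : IsSmooth (X * φ - φ * X) := (hX.mul isSmooth_φ).sub (isSmooth_φ.mul hX)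
  have heq : ∀ y ∈ u, ext (fun K => dAlong s K ⁅X K, (K : V →L[ℝ] V)⁆) y =
      s' y (ext (X * φ - φ * X) y) := fun y hy => by
    let K : Twistor V := ⟨y, hut hy⟩
    have h1 := ext_apply (fun K => dAlong s K ⁅X K, (K : V →L[ℝ] V)⁆) K
    have h2 := ext_apply (X * φ - φ * X) K
    rw [h1, h2]
    exact (hs.hasDerivAt_flow ⟨X K, hXo K⟩ K).unique
      (hasDerivAt_comp_flow (hs' y hy) ⟨X K, hXo K⟩)
  exact (hs'_smooth.clm_apply ((hY x hx).of_le (by exact_mod_cast le_top))).congr_of_eventuallyEq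
    (mem_of_superset hu heq) (heq x (mem_of_mem_nhdsWithin hx hu))

end Calculus

section Equivariant

variable {V : Type*} [NormedAddCommGroup V] [InnerProductSpace ℝ V]

/-- The algebra of smooth functions on the twistor space that are invariant under the isometries of
`V` that fix `J`. -/
def invariantFun (J : Twistor V) : Subalgebra ℝ (Twistor V → ℝ) where
  carrier := {f | IsSmooth f ∧ ∀ R : V ≃ₗᵢ[ℝ] V, conj R J = J → ∀ K, f (conj R K) = f K}
  mul_mem' hf hg := ⟨hf.1.smul hg.1, fun R hR K => by
    simp only [Pi.mul_apply, hf.2 R hR K, hg.2 R hR K]⟩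
  add_mem' hf hg := ⟨hf.1.add hg.1, fun R hR K => by
    simp only [Pi.add_apply, hf.2 R hR K, hg.2 R hR K]⟩
  algebraMap_mem' r := ⟨isSmooth_const r, fun _ _ _ => rfl⟩

/-- The algebra of smooth sections of `End V × 𝒯` that are equivariant under the isometries of `V`
that fix `J`. -/
def equivariantEnd (J : Twistor V) : Subalgebra ℝ (Twistor V → (V →L[ℝ] V)) where
  carrier := {s | IsSmooth s ∧ ∀ R : V ≃ₗᵢ[ℝ] V, conj R J = J → ∀ K,
    s (conj R K) = (R : V →L[ℝ] V) * s K * (R.symm : V →L[ℝ] V)}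
  mul_mem' {s t} hs ht := ⟨hs.1.mul ht.1, fun R hR K => by
    calc s (conj R K) * t (conj R K)
        = R * s K * ((R.symm : V →L[ℝ] V) * (R : V →L[ℝ] V)) * t K * R.symm := by
          rw [hs.2 R hR K, ht.2 R hR K]; simp only [mul_assoc]
      _ = R * (s K * t K) * R.symm := by rw [coe_symm_mul_coe, mul_one, mul_assoc _ (s K)]⟩
  add_mem' hs ht := ⟨hs.1.add ht.1, fun R hR K => by
    simp only [Pi.add_apply, hs.2 R hR K, ht.2 R hR K, mul_add, add_mul]⟩
  algebraMap_mem' r := ⟨isSmooth_const _, fun R _ _ => by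
    rw [Pi.algebraMap_apply, Pi.algebraMap_apply, ← Algebra.commutes, mul_assoc, coe_mul_coe_symm,
      mul_one]⟩

theorem smul_mem_equivariantEnd {J : Twistor V} {f : Twistor V → ℝ} {s : Twistor V → (V →L[ℝ] V)}
    (hf : f ∈ invariantFun J) (hs : s ∈ equivariantEnd J) : f • s ∈ equivariantEnd J :=
  ⟨hf.1.smul hs.1, fun R hR K => by
    simp only [Pi.smul_apply', hf.2 R hR K, hs.2 R hR K, mul_smul_comm, smul_mul_assoc]⟩

/-- The algebra of noncommutative polynomials in the sections `J` and `φ`. -/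
def wordAlgebra (J : Twistor V) : Subalgebra ℝ (Twistor V → (V →L[ℝ] V)) :=
  Algebra.adjoin ℝ {cst J, φ}

theorem cst_mem_wordAlgebra (J : Twistor V) : cst J ∈ wordAlgebra J :=
  Algebra.subset_adjoin (Set.mem_insert _ _)

theorem φ_mem_wordAlgebra (J : Twistor V) : φ ∈ wordAlgebra J :=
  Algebra.subset_adjoin (Set.mem_insert_of_mem _ rfl)

theorem anti_mem_wordAlgebra (J : Twistor V) : anti J ∈ wordAlgebra J :=
  add_mem (mul_mem (cst_mem_wordAlgebra J) (φ_mem_wordAlgebra J))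
    (mul_mem (φ_mem_wordAlgebra J) (cst_mem_wordAlgebra J))

theorem letters_subset_wordAlgebra (J : Twistor V) : letters J ⊆ wordAlgebra J := by
  have hJ := cst_mem_wordAlgebra J
  have hφ := φ_mem_wordAlgebra J
  rintro c (rfl | rfl | rfl | rfl)
  exacts [hJ, neg_mem hJ, hφ, neg_mem hφ]

theorem sSet_subset_wordAlgebra (J : Twistor V) : sSet J ⊆ wordAlgebra J := by
  have hJ := cst_mem_wordAlgebra J
  have hφ := φ_mem_wordAlgebra J
  rintro S (rfl | rfl | rfl | rfl)
  exacts [one_mem _, add_mem hJ hφ, sub_mem hJ hφ, sub_mem (mul_mem hJ hφ) (mul_mem hφ hJ)]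

theorem wordAlgebra_le_equivariantEnd (J : Twistor V) : wordAlgebra J ≤ equivariantEnd J := by
  refine Algebra.adjoin_le ?_
  rintro s (rfl | rfl)
  · exact ⟨isSmooth_const _, fun R hR _ => (congr_arg Subtype.val hR).symm⟩
  · exact ⟨isSmooth_φ, fun _ _ _ => rfl⟩

theorem cst_mul_cst (J : Twistor V) : cst J * cst J = -1 := funext fun _ => sq_eq J

theorem φ_mul_φ : (φ : Twistor V → (V →L[ℝ] V)) * φ = -1 := funext sq_eq

theorem anti_commute_of_mem_wordAlgebra {J : Twistor V} {w : Twistor V → (V →L[ℝ] V)}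
    (hw : w ∈ wordAlgebra J) : Commute (anti J) w := by
  have hle : wordAlgebra J ≤ Subalgebra.centralizer ℝ {anti J} := by
    refine Algebra.adjoin_le ?_
    rintro s (rfl | rfl) _ rfl <;> rw [anti]
    · rw [add_mul, mul_add, mul_assoc φ, cst_mul_cst, ← mul_assoc (cst J) (cst J), cst_mul_cst]
      noncomm_ring
    · rw [add_mul, mul_add, mul_assoc (cst J), φ_mul_φ, ← mul_assoc φ φ, φ_mul_φ]
      noncomm_ring
  exact (Subalgebra.mem_centralizer_iff ℝ).1 (hle hw) _ rfl

theorem polyQ_eq_sum (J : Twistor V) (k : ℕ) (a : ℕ → Twistor V → ℝ) :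
    polyQ J k a = ∑ i ∈ Finset.range (k + 1), a i • anti J ^ i := by
  ext1 K
  simp [polyQ]

theorem polyQ_commute_of_mem_wordAlgebra {J : Twistor V} (k : ℕ) (a : ℕ → Twistor V → ℝ)
    {w : Twistor V → (V →L[ℝ] V)} (hw : w ∈ wordAlgebra J) : Commute (polyQ J k a) w := by
  rw [polyQ_eq_sum]
  exact Commute.sum_left _ _ _ fun i _ =>
    ((anti_commute_of_mem_wordAlgebra hw).pow_left i).smul_left (a i)

theorem polyQ_mem_equivariantEnd {J : Twistor V} {k : ℕ} {a : ℕ → Twistor V → ℝ}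
    (ha : ∀ i ≤ k, a i ∈ invariantFun J) : polyQ J k a ∈ equivariantEnd J := by
  have hanti := wordAlgebra_le_equivariantEnd J (anti_mem_wordAlgebra J)
  rw [polyQ_eq_sum]
  exact sum_mem fun i hi =>
    smul_mem_equivariantEnd (ha i (Finset.mem_range_succ_iff.1 hi)) (pow_mem hanti i)

theorem contDiff_charpoly_coeff [FiniteDimensional ℝ V] (i : ℕ) :
    ContDiff ℝ ∞ fun A : V →L[ℝ] V => (LinearMap.charpoly (A : V →ₗ[ℝ] V)).coeff i := by
  let b := Module.finBasis ℝ (V →L[ℝ] V)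
  let f : (V →L[ℝ] V) →ₗ[ℝ] End ℝ V := ContinuousLinearMap.coeLM ℝ
  let p := (LinearMap.polyCharpoly f b).coeff i
  have heval : (fun A : V →L[ℝ] V => (LinearMap.charpoly (A : V →ₗ[ℝ] V)).coeff i) =
      fun A => MvPolynomial.eval (b.equivFun.toContinuousLinearEquiv A) p := by
    ext A
    rw [LinearEquiv.coe_toContinuousLinearEquiv', Basis.equivFun_apply,
      LinearMap.polyCharpoly_coeff_eval]
    rfl
  rw [heval]
  exact (AnalyticOnNhd.eval_mvPolynomial p).contDiff.comp
    b.equivFun.toContinuousLinearEquiv.contDiff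

theorem symFun_mem_invariantFun [FiniteDimensional ℝ V] (J : Twistor V) (n j : ℕ) :
    symFun J n j ∈ invariantFun J := by
  obtain ⟨hsmooth, hequiv⟩ := wordAlgebra_le_equivariantEnd J (anti_mem_wordAlgebra J)
  refine ⟨(isSmooth_const _).smul (hsmooth.contDiff_comp (contDiff_charpoly_coeff _)),
    fun R hR K => ?_⟩
  rw [symFun, symFun, hequiv R hR K, ← LinearEquiv.charpoly_conj R.toLinearEquiv (anti J K)]
  rfl

theorem adjoin_symFun_le_invariantFun [FiniteDimensional ℝ V] (J : Twistor V) (n : ℕ) (I : Set ℕ) :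
    Algebra.adjoin ℝ (symFun J n '' I) ≤ invariantFun J :=
  Algebra.adjoin_le (Set.image_subset_iff.2 fun j _ => symFun_mem_invariantFun J n j)

end Equivariant

section LieDerivative

variable {V : Type*} [NormedAddCommGroup V] [InnerProductSpace ℝ V]

/-- The pullback `K ↦ R⁻¹ s(R K R⁻¹) R` of a section `s` of `End V × 𝒯` along an isometry `R`. -/
def pullback (R : V ≃ₗᵢ[ℝ] V) : (Twistor V → (V →L[ℝ] V)) →ₐ[ℝ] (Twistor V → (V →L[ℝ] V)) where
  toFun s K := (R.symm : V →L[ℝ] V) * s (conj R K) * (R : V →L[ℝ] V)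
  map_one' := by ext1 K; simp only [Pi.one_apply, mul_one, coe_symm_mul_coe]
  map_mul' s t := by
    ext1 K
    calc (R.symm : V →L[ℝ] V) * (s (conj R K) * t (conj R K)) * R
        = R.symm * s (conj R K) * 1 * t (conj R K) * R := by simp only [mul_one, mul_assoc]
      _ = R.symm * s (conj R K) * R * (R.symm * t (conj R K) * R) := by
          rw [← coe_mul_coe_symm R]; simp only [mul_assoc]
  map_zero' := by ext1 K; simp only [Pi.zero_apply, mul_zero, zero_mul]
  map_add' s t := by ext1 K; simp only [Pi.add_apply, mul_add, add_mul]
  commutes' r := by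
    ext1 K
    rw [Pi.algebraMap_apply, Pi.algebraMap_apply, ← Algebra.commutes, mul_assoc, coe_symm_mul_coe,
      mul_one]

theorem pullback_smul (R : V ≃ₗᵢ[ℝ] V) (f : Twistor V → ℝ) (s : Twistor V → (V →L[ℝ] V))
    (K : Twistor V) : pullback R (f • s) K = f (conj R K) • pullback R s K := by
  change (R.symm : V →L[ℝ] V) * (f (conj R K) • s (conj R K)) * R = _
  rw [mul_smul_comm, smul_mul_assoc]
  rfl

theorem pullback_eq_self {J : Twistor V} {s : Twistor V → (V →L[ℝ] V)} (hs : s ∈ equivariantEnd J)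
    {R : V ≃ₗᵢ[ℝ] V} (hR : conj R J = J) : pullback R s = s := by
  ext1 K
  calc (R.symm : V →L[ℝ] V) * s (conj R K) * R
      = (R.symm * R) * s K * (R.symm * R) := by rw [hs.2 R hR K]; simp only [mul_assoc]
    _ = s K := by rw [coe_symm_mul_coe, one_mul, mul_one]

/-- The Lie derivative at `K` of a section `s` of `End V × 𝒯`, for the infinitesimal action of
`A ∈ 𝔬(V,g)` by conjugation on `End V` and on the twistor space. -/
noncomputable def lieDeriv (A : V →L[ℝ] V) (s : Twistor V → (V →L[ℝ] V)) (K : Twistor V) :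
    V →L[ℝ] V :=
  dAlong s K ⁅A, (K : V →L[ℝ] V)⁆ - ⁅A, s K⁆

theorem lieDeriv_add_left (A B : V →L[ℝ] V) (s : Twistor V → (V →L[ℝ] V)) (K : Twistor V) :
    lieDeriv (A + B) s K = lieDeriv A s K + lieDeriv B s K := by
  simp only [lieDeriv, dAlong, Ring.lie_def, add_mul, mul_add, map_add, map_sub]
  abel

theorem lieDeriv_smul_left (r : ℝ) (A : V →L[ℝ] V) (s : Twistor V → (V →L[ℝ] V)) (K : Twistor V) :
    lieDeriv (r • A) s K = r • lieDeriv A s K := by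
  simp only [lieDeriv, dAlong, Ring.lie_def, smul_mul_assoc, mul_smul_comm, ← smul_sub, map_smul]

variable [CompleteSpace V] {A : V →L[ℝ] V} {s t : Twistor V → (V →L[ℝ] V)}

theorem hasDerivAt_pullback (hs : IsSmooth s) (hA : A ∈ orth V) (K : Twistor V) :
    HasDerivAt (fun r : ℝ => pullback (expIsometry (r • ⟨A, hA⟩)) s K) (lieDeriv A s K) 0 := by
  have h := ((hasDerivAt_expIsometry_symm ⟨A, hA⟩).mul (hs.hasDerivAt_flow ⟨A, hA⟩ K)).mul
    (hasDerivAt_expIsometry ⟨A, hA⟩)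
  simp only [Pi.mul_apply, flow_zero, zero_smul, expIsometry_zero] at h
  refine h.congr_deriv ?_
  change (-A * s K + 1 * dAlong s K ⁅A, (K : V →L[ℝ] V)⁆) * 1 + 1 * s K * A = lieDeriv A s K
  rw [lieDeriv, Ring.lie_def A (s K)]
  noncomm_ring

theorem pullback_expIsometry_zero (hA : A ∈ orth V) (s : Twistor V → (V →L[ℝ] V)) (K : Twistor V) :
    pullback (expIsometry ((0 : ℝ) • ⟨A, hA⟩)) s K = s K := by
  have hK : conj (expIsometry ((0 : ℝ) • ⟨A, hA⟩)) K = K := flow_zero ⟨A, hA⟩ K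
  change ((expIsometry ((0 : ℝ) • ⟨A, hA⟩)).symm : V →L[ℝ] V) * s (conj _ K) * _ = s K
  rw [hK, zero_smul, expIsometry_zero]
  rfl

theorem lieDeriv_add (hs : IsSmooth s) (ht : IsSmooth t) (hA : A ∈ orth V) (K : Twistor V) :
    lieDeriv A (s + t) K = lieDeriv A s K + lieDeriv A t K := by
  refine (hasDerivAt_pullback (hs.add ht) hA K).unique ?_
  exact ((hasDerivAt_pullback hs hA K).add (hasDerivAt_pullback ht hA K)).congr_of_eventuallyEq
    (Eventually.of_forall fun _ => congr_fun (map_add _ s t) K)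

theorem lieDeriv_sub (hs : IsSmooth s) (ht : IsSmooth t) (hA : A ∈ orth V) (K : Twistor V) :
    lieDeriv A (s - t) K = lieDeriv A s K - lieDeriv A t K := by
  refine (hasDerivAt_pullback (hs.sub ht) hA K).unique ?_
  exact ((hasDerivAt_pullback hs hA K).sub (hasDerivAt_pullback ht hA K)).congr_of_eventuallyEq
    (Eventually.of_forall fun _ => congr_fun (map_sub _ s t) K)

theorem lieDeriv_const_smul (r : ℝ) (hs : IsSmooth s) (hA : A ∈ orth V) (K : Twistor V) :
    lieDeriv A (r • s) K = r • lieDeriv A s K := by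
  refine (hasDerivAt_pullback ((isSmooth_const r).smul hs) hA K).unique ?_
  exact ((hasDerivAt_pullback hs hA K).const_smul r).congr_of_eventuallyEq
    (Eventually.of_forall fun t => pullback_smul _ (fun _ => r) s K)

theorem lieDeriv_mul (hs : IsSmooth s) (ht : IsSmooth t) (hA : A ∈ orth V) (K : Twistor V) :
    lieDeriv A (s * t) K = lieDeriv A s K * t K + s K * lieDeriv A t K := by
  refine (hasDerivAt_pullback (hs.mul ht) hA K).unique ?_
  have h := (hasDerivAt_pullback hs hA K).mul (hasDerivAt_pullback ht hA K)
  simp only [pullback_expIsometry_zero] at h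
  exact h.congr_of_eventuallyEq (Eventually.of_forall fun _ => congr_fun (map_mul _ s t) K)

theorem lieDeriv_smul {f : Twistor V → ℝ} (hf : IsSmooth f) (hs : IsSmooth s) (hA : A ∈ orth V)
    (K : Twistor V) :
    lieDeriv A (f • s) K = f K • lieDeriv A s K + dAlong f K ⁅A, (K : V →L[ℝ] V)⁆ • s K := by
  refine (hasDerivAt_pullback (hf.smul hs) hA K).unique ?_
  have h := (hf.hasDerivAt_flow ⟨A, hA⟩ K).smul (hasDerivAt_pullback hs hA K)
  simp only [pullback_expIsometry_zero, flow_zero] at h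
  exact h.congr_of_eventuallyEq (Eventually.of_forall fun _ => pullback_smul _ f s K)

theorem lieDeriv_eq_zero {J : Twistor V} (hs : s ∈ equivariantEnd J) (hA : A ∈ orth V)
    (hAJ : Commute A J) (K : Twistor V) : lieDeriv A s K = 0 := by
  refine (hasDerivAt_pullback hs.1 hA K).unique ?_
  have hfix (r : ℝ) : pullback (expIsometry (r • ⟨A, hA⟩)) s = s :=
    pullback_eq_self hs (conj_expIsometry_eq_self (hAJ.smul_left r))
  simpa only [hfix] using hasDerivAt_const (0 : ℝ) (s K)

theorem isClosed_bundle (γ δ : Twistor V → (V →L[ℝ] V)) (K : Twistor V) :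
    IsClosed (bundle γ δ K : Set (V →L[ℝ] V)) :=
  isClosed_orth.inter (isClosed_eq (continuous_const_mul _) (continuous_mul_const _))

theorem pullback_mem_bundle {J : Twistor V} {γ δ : Twistor V → (V →L[ℝ] V)}
    (hγ : γ ∈ equivariantEnd J) (hδ : δ ∈ equivariantEnd J) (hs : ∀ K, s K ∈ bundle γ δ K)
    {R : V ≃ₗᵢ[ℝ] V} (hR : conj R J = J) (K : Twistor V) : pullback R s K ∈ bundle γ δ K := by
  constructor
  · have hstar : star (R.symm : V →L[ℝ] V) = R := R.symm.star_eq_symm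
    change (R.symm : V →L[ℝ] V) * s (conj R K) * R ∈ orth V
    rw [← hstar]
    exact mul_mul_star_mem_orth _ (hs (conj R K)).1
  · have hcomm : γ * s = s * δ := funext fun K => (hs K).2
    have hpull := congr_arg (pullback R) hcomm
    rw [map_mul, map_mul, pullback_eq_self hγ hR, pullback_eq_self hδ hR] at hpull
    exact congr_fun hpull K

theorem lieDeriv_mem_bundle {J : Twistor V} {γ δ : Twistor V → (V →L[ℝ] V)}
    (hγ : γ ∈ equivariantEnd J) (hδ : δ ∈ equivariantEnd J) (hs : IsSmooth s)
    (hmem : ∀ K, s K ∈ bundle γ δ K) (hA : A ∈ orth V) (hAJ : Commute A J) (K : Twistor V) :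
    lieDeriv A s K ∈ bundle γ δ K := by
  refine (isClosed_bundle γ δ K).mem_of_tendsto (hasDerivAt_pullback hs hA K).tendsto_slope
    (Eventually.of_forall fun r => ?_)
  have hcurve (r : ℝ) : pullback (expIsometry (r • ⟨A, hA⟩)) s K ∈ bundle γ δ K :=
    pullback_mem_bundle hγ hδ hmem (conj_expIsometry_eq_self (hAJ.smul_left r)) K
  exact Submodule.smul_mem _ _ (sub_mem (hcurve r) (hcurve 0))

theorem IsSmooth.lieDeriv {X : Twistor V → (V →L[ℝ] V)} (hs : IsSmooth s) (hX : IsSmooth X)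
    (hXo : ∀ K, X K ∈ orth V) : IsSmooth fun K => lieDeriv (X K) s K :=
  (hs.dAlong_lie hX hXo).sub ((hX.mul hs).sub (hs.mul hX))

end LieDerivative

section VectorBundle

open ContinuousLinearMap

section IsProj

variable {M : Type*} [NormedAddCommGroup M] [NormedSpace ℝ M] {E E' : Submodule ℝ M}
  {P Q : M →L[ℝ] M}

theorem disjoint_ker_of_isProj_of_norm_sub_lt_one (hP : LinearMap.IsProj E P) (hPQ : ‖P - Q‖ < 1) :
    Disjoint E (LinearMap.ker (Q : M →ₗ[ℝ] M)) := by
  refine Submodule.disjoint_def.2 fun x hx hQx => ?_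
  have hfix : (P - Q) x = x := by
    rw [sub_apply, show Q x = 0 from hQx, sub_zero, hP.map_id x hx]
  by_contra hx0
  have hle := (P - Q).le_opNorm x
  rw [hfix] at hle
  exact hle.not_gt (mul_lt_of_lt_one_left (norm_pos_iff.2 hx0) hPQ)

variable [FiniteDimensional ℝ M]

theorem finrank_le_of_isProj_of_norm_sub_lt_one (hP : LinearMap.IsProj E P)
    (hQ : LinearMap.IsProj E' Q) (hPQ : ‖P - Q‖ < 1) : finrank ℝ E ≤ finrank ℝ E' := by
  have hdisj := disjoint_ker_of_isProj_of_norm_sub_lt_one hP hPQ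
  refine LinearMap.finrank_le_finrank_of_injective
    (f := ((Q : M →ₗ[ℝ] M).domRestrict E).codRestrict E' fun x => hQ.map_mem x) ?_
  exact LinearMap.ker_eq_bot.1 <| LinearMap.ker_eq_bot'.2 fun x hx =>
    Subtype.ext (Submodule.disjoint_def.1 hdisj x x.2 (congr_arg Subtype.val hx))

theorem linearIndependent_and_span_eq_of_isProj (hP : LinearMap.IsProj E P)
    (hQ : LinearMap.IsProj E' Q) (hPQ : ‖P - Q‖ < 1) {ι : Type*} [Finite ι] (b : Basis ι ℝ E) :
    LinearIndependent ℝ (fun i => Q (b i)) ∧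
      Submodule.span ℝ (Set.range fun i => Q (b i)) = E' := by
  cases nonempty_fintype ι
  have hdisj := disjoint_ker_of_isProj_of_norm_sub_lt_one hP hPQ
  have hli : LinearIndependent ℝ fun i => Q (b i) := by
    refine (b.linearIndependent.map' E.subtype E.ker_subtype).map (f := (Q : M →ₗ[ℝ] M))
      (hdisj.mono_left (Submodule.span_le.2 ?_))
    rintro _ ⟨i, rfl⟩
    exact (b i).2
  refine ⟨hli, Submodule.eq_of_le_of_finrank_le (Submodule.span_le.2 ?_) ?_⟩
  · rintro _ ⟨i, rfl⟩
    exact hQ.map_mem _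
  · rw [finrank_span_eq_card hli, ← finrank_eq_card_basis b]
    exact finrank_le_of_isProj_of_norm_sub_lt_one hQ hP (by rwa [norm_sub_rev])

end IsProj

variable {V : Type*} [NormedAddCommGroup V] [InnerProductSpace ℝ V]

section Projection

variable [CompleteSpace V]

/-- The projection of `End V` onto the skew endomorphisms that commute with the complex
structure `c`. -/
noncomputable def skewCommutantProj (c : V →L[ℝ] V) : (V →L[ℝ] V) →L[ℝ] (V →L[ℝ] V) :=
  (1 / 4 : ℝ) • (ContinuousLinearMap.id ℝ (V →L[ℝ] V) - mulLeftRight ℝ (V →L[ℝ] V) c c) ∘L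
    (ContinuousLinearMap.id ℝ (V →L[ℝ] V) -
      ((starL' ℝ : (V →L[ℝ] V) ≃L[ℝ] (V →L[ℝ] V)) : (V →L[ℝ] V) →L[ℝ] (V →L[ℝ] V)))

theorem contDiff_skewCommutantProj :
    ContDiff ℝ ∞ (skewCommutantProj : (V →L[ℝ] V) → (V →L[ℝ] V) →L[ℝ] (V →L[ℝ] V)) := by
  unfold skewCommutantProj
  fun_prop

theorem skewCommutantProj_apply (c A : V →L[ℝ] V) :
    skewCommutantProj c A = (1 / 4 : ℝ) • ((A - star A) - c * (A - star A) * c) := rfl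

theorem isProj_skewCommutantProj {c : Twistor V → (V →L[ℝ] V)} {K : Twistor V}
    (hc : c K ∈ twistorSet V) : LinearMap.IsProj (bundle c c K) (skewCommutantProj (c K)) where
  map_mem A := by
    rw [skewCommutantProj_apply]
    refine Submodule.smul_mem _ _ ⟨?_, ?_⟩
    · have hskew : A - star A ∈ orth V := by
        rw [mem_orth_iff_star, star_sub, star_star, neg_sub]
      have hconj := mul_mul_star_mem_orth (c K) hskew
      rw [star_eq_neg_of_mem_twistorSet hc, mul_neg] at hconj
      simpa only [sub_eq_add_neg] using add_mem hskew hconj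
    · rw [mul_sub, sub_mul, mul_assoc (c K * _), hc.1, ← mul_assoc, ← mul_assoc, hc.1]
      noncomm_ring
  map_id A hA := by
    have hcomm : c K * A * c K = -A := by rw [hA.2, mul_assoc, hc.1, mul_neg_one]
    rw [skewCommutantProj_apply, mem_orth_iff_star.1 hA.1, sub_neg_eq_add, mul_add, add_mul, hcomm]
    module

end Projection

variable [FiniteDimensional ℝ V]

theorem isVectorBundle_of_isProj {E : Twistor V → Submodule ℝ (V →L[ℝ] V)}
    {P : Twistor V → (V →L[ℝ] V) →L[ℝ] (V →L[ℝ] V)} (hP : IsSmooth P)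
    (hproj : ∀ K, LinearMap.IsProj (E K) (P K)) : IsVectorBundle E := by
  intro K
  let b := finBasis ℝ (E K)
  refine ⟨finrank ℝ (E K), fun i => ⟨fun L => P L (b i), hP.clm_apply (isSmooth_const _),
    fun L => (hproj L).map_mem _⟩, ?_⟩
  have hnear : ∀ᶠ L in 𝓝 K, dist (P K) (P L) < 1 :=
    (continuous_const.dist hP.continuous).continuousAt.eventually_lt_const (by simp)
  filter_upwards [hnear] with L hL
  exact linearIndependent_and_span_eq_of_isProj (hproj K) (hproj L)
    ((dist_eq_norm (P K) (P L)).symm.trans_lt hL) b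

theorem isVectorBundle_bundle {c : Twistor V → (V →L[ℝ] V)} (hc : IsSmooth c)
    (hc' : ∀ K, c K ∈ twistorSet V) : IsVectorBundle (bundle c c) :=
  isVectorBundle_of_isProj (hc.contDiff_comp contDiff_skewCommutantProj)
    fun K => isProj_skewCommutantProj (hc' K)

end VectorBundle

section Intertwiner

variable {V : Type*} [NormedAddCommGroup V] [InnerProductSpace ℝ V]

theorem anchor_apply (F : Twistor V → (V →L[ℝ] V)) (K : Twistor V) (A : V →L[ℝ] V) :
    anchor F K A = ⁅F K * A * F K, (K : V →L[ℝ] V)⁆ := rfl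

variable [CompleteSpace V]

/-- `F` is an equivariant section that is symmetric or skew and that intertwines `J` with the
equivariant section `c` of complex structures, in both directions. It is what `ψ(A) = [FAF, φ]`
has to satisfy in order to be the anchor of a skew algebroid on `bundle c c`. -/
structure IsIntertwiner (J : Twistor V) (F c : Twistor V → (V →L[ℝ] V)) : Prop where
  mem_equivariantEnd : F ∈ equivariantEnd J
  right_mem_equivariantEnd : c ∈ equivariantEnd J
  right_mem_twistorSet : ∀ K, c K ∈ twistorSet V
  cst_mul : cst J * F = F * c
  mul_cst : F * cst J = c * F
  star_eq : star F = F ∨ star F = -F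

namespace IsIntertwiner

variable {J : Twistor V} {F c : Twistor V → (V →L[ℝ] V)}

theorem mul_mul_mem_orth (h : IsIntertwiner J F c) (K : Twistor V) {A : V →L[ℝ] V}
    (hA : A ∈ orth V) : F K * A * F K ∈ orth V := by
  have hmem := mul_mul_star_mem_orth (F K) hA
  rw [← Pi.star_apply] at hmem
  rcases h.star_eq with hs | hs <;> rw [hs] at hmem
  · exact hmem
  · rwa [Pi.neg_apply, mul_neg, neg_mem_iff] at hmem

theorem mul_sq_mul_sub_mem_orth (h : IsIntertwiner J F c) (K : Twistor V) {A B : V →L[ℝ] V}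
    (hA : A ∈ orth V) (hB : B ∈ orth V) :
    A * (F K * F K) * B - B * (F K * F K) * A ∈ orth V := by
  have hstar : star (F K * F K) = F K * F K := by
    have hFF : star (F * F) = F * F := by
      rw [star_mul]
      rcases h.star_eq with hs | hs <;> rw [hs]
      exact neg_mul_neg F F
    exact congr_fun hFF K
  rw [mem_orth_iff_star] at *
  simp only [star_sub, star_mul, hstar, hA, hB]
  noncomm_ring

theorem mul_mul_commute (h : IsIntertwiner J F c) {K : Twistor V} {A : V →L[ℝ] V}
    (hA : A ∈ bundle c c K) : Commute (F K * A * F K) J := by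
  have hJF : (J : V →L[ℝ] V) * F K = F K * c K := congr_fun h.cst_mul K
  have hFJ : F K * (J : V →L[ℝ] V) = c K * F K := congr_fun h.mul_cst K
  calc F K * A * F K * (J : V →L[ℝ] V)
      = F K * (A * c K) * F K := by rw [mul_assoc, hFJ]; simp only [mul_assoc]
    _ = J * (F K * A * F K) := by rw [← hA.2, ← mul_assoc, ← hJF]; simp only [mul_assoc]

theorem commute_mul_self (h : IsIntertwiner J F c) : Commute c (F * F) := by
  change c * (F * F) = F * F * c
  rw [← mul_assoc, ← h.mul_cst, mul_assoc, h.cst_mul, mul_assoc]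

theorem isSmooth_mul_mul (h : IsIntertwiner J F c) {A : Twistor V → (V →L[ℝ] V)}
    (hA : IsSmooth A) : IsSmooth (F * A * F) :=
  (h.mem_equivariantEnd.1.mul hA).mul h.mem_equivariantEnd.1

theorem isSmooth_anchor (h : IsIntertwiner J F c) {A : Twistor V → (V →L[ℝ] V)}
    (hA : IsSmooth A) : IsSmooth fun K => anchor F K (A K) :=
  ((h.isSmooth_mul_mul hA).mul isSmooth_φ).sub (isSmooth_φ.mul (h.isSmooth_mul_mul hA))

theorem lieDeriv_anchor (h : IsIntertwiner J F c) {B : Twistor V → (V →L[ℝ] V)} (hB : IsSmooth B)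
    {X : V →L[ℝ] V} (hX : X ∈ orth V) (hXJ : Commute X J) (K : Twistor V) :
    lieDeriv X (fun L => anchor F L (B L)) K = anchor F K (lieDeriv X B K) := by
  have hF := h.mem_equivariantEnd.1
  have hFB := h.isSmooth_mul_mul hB
  have hF0 := lieDeriv_eq_zero h.mem_equivariantEnd hX hXJ K
  have hφ0 := lieDeriv_eq_zero (wordAlgebra_le_equivariantEnd J (φ_mem_wordAlgebra J)) hX hXJ K
  change lieDeriv X (F * B * F * φ - φ * (F * B * F)) K = _
  rw [lieDeriv_sub (hFB.mul isSmooth_φ) (isSmooth_φ.mul hFB) hX, lieDeriv_mul hFB isSmooth_φ hX,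
    lieDeriv_mul isSmooth_φ hFB hX, lieDeriv_mul (hF.mul hB) hF hX, lieDeriv_mul hF hB hX, hF0, hφ0]
  simp only [zero_mul, mul_zero, zero_add, add_zero]
  rfl

/-- The map `(A, B) ↦ ∇_A B` on sections, where `∇_A B` is the Lie derivative of `B` along the
endomorphism `FAF`. -/
noncomputable def connection (h : IsIntertwiner J F c) :
    Sections (bundle c c) →ₗ[ℝ] Sections (bundle c c) →ₗ[ℝ] Sections (bundle c c) :=
  LinearMap.mk₂ ℝ
    (fun A B => ⟨fun K => lieDeriv (F K * A.1 K * F K) B.1 K,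
      B.2.1.lieDeriv (h.isSmooth_mul_mul A.2.1) fun K => h.mul_mul_mem_orth K (A.2.2 K).1,
      fun K => lieDeriv_mem_bundle h.right_mem_equivariantEnd h.right_mem_equivariantEnd B.2.1 B.2.2
        (h.mul_mul_mem_orth K (A.2.2 K).1) (h.mul_mul_commute (A.2.2 K)) K⟩)
    (fun A A' B => Subtype.ext <| funext fun K => by
      change lieDeriv (F K * (A.1 K + A'.1 K) * F K) B.1 K = _
      rw [mul_add, add_mul, lieDeriv_add_left]
      rfl)
    (fun r A B => Subtype.ext <| funext fun K => by
      change lieDeriv (F K * (r • A.1 K) * F K) B.1 K = _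
      rw [mul_smul_comm, smul_mul_assoc, lieDeriv_smul_left]
      rfl)
    (fun A B B' => Subtype.ext <| funext fun K =>
      lieDeriv_add B.2.1 B'.2.1 (h.mul_mul_mem_orth K (A.2.2 K).1) K)
    (fun r A B => Subtype.ext <| funext fun K =>
      lieDeriv_const_smul r B.2.1 (h.mul_mul_mem_orth K (A.2.2 K).1) K)

theorem connection_apply (h : IsIntertwiner J F c) (A B : Sections (bundle c c)) (K : Twistor V) :
    (h.connection A B).1 K = lieDeriv (F K * A.1 K * F K) B.1 K := rfl

/-- The pointwise bracket `(A, B) ↦ AF²B - BF²A` on sections. The map `A ↦ FAF` sends it to the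
commutator. -/
noncomputable def fibreBracket (h : IsIntertwiner J F c) :
    Sections (bundle c c) →ₗ[ℝ] Sections (bundle c c) →ₗ[ℝ] Sections (bundle c c) :=
  LinearMap.mk₂ ℝ
    (fun A B => ⟨A.1 * (F * F) * B.1 - B.1 * (F * F) * A.1, by
      have hFF := h.mem_equivariantEnd.1.mul h.mem_equivariantEnd.1
      exact ((A.2.1.mul hFF).mul B.2.1).sub ((B.2.1.mul hFF).mul A.2.1), fun K => by
      have hA : Commute c A.1 := funext fun L => (A.2.2 L).2
      have hB : Commute c B.1 := funext fun L => (B.2.2 L).2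
      have hFF := h.commute_mul_self
      have hcomm : Commute c (A.1 * (F * F) * B.1 - B.1 * (F * F) * A.1) :=
        ((hA.mul_right hFF).mul_right hB).sub_right ((hB.mul_right hFF).mul_right hA)
      exact ⟨h.mul_sq_mul_sub_mem_orth K (A.2.2 K).1 (B.2.2 K).1, congr_fun hcomm.eq K⟩⟩)
    (fun A A' B => Subtype.ext (by
      change (A.1 + A'.1) * _ * B.1 - B.1 * _ * (A.1 + A'.1) = _ + _
      noncomm_ring))
    (fun r A B => Subtype.ext (by
      change (r • A.1) * _ * B.1 - B.1 * _ * (r • A.1) = r • (_ - _)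
      simp only [smul_mul_assoc, mul_smul_comm, smul_sub]))
    (fun A B B' => Subtype.ext (by
      change A.1 * _ * (B.1 + B'.1) - (B.1 + B'.1) * _ * A.1 = _ + _
      noncomm_ring))
    (fun r A B => Subtype.ext (by
      change A.1 * _ * (r • B.1) - (r • B.1) * _ * A.1 = r • (_ - _)
      simp only [smul_mul_assoc, mul_smul_comm, smul_sub]))

theorem fibreBracket_apply (h : IsIntertwiner J F c) (A B : Sections (bundle c c)) (K : Twistor V) :
    (h.fibreBracket A B).1 K = A.1 K * (F K * F K) * B.1 K - B.1 K * (F K * F K) * A.1 K := rfl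

/-- The bracket `[A, B]_F = ∇_A B - ∇_B A + (AF²B - BF²A)` on sections. -/
noncomputable def bracket (h : IsIntertwiner J F c) :
    Sections (bundle c c) →ₗ[ℝ] Sections (bundle c c) →ₗ[ℝ] Sections (bundle c c) :=
  LinearMap.mk₂ ℝ (fun A B => h.connection A B - h.connection B A + h.fibreBracket A B)
    (fun A A' B => by simp only [map_add, LinearMap.add_apply]; abel)
    (fun r A B => by simp only [map_smul, LinearMap.smul_apply, smul_add, smul_sub])
    (fun A B B' => by simp only [map_add, LinearMap.add_apply]; abel)
    (fun r A B => by simp only [map_smul, LinearMap.smul_apply, smul_add, smul_sub])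

theorem bracket_apply (h : IsIntertwiner J F c) (A B : Sections (bundle c c)) (K : Twistor V) :
    (h.bracket A B).1 K =
      (h.connection A B).1 K - (h.connection B A).1 K + (h.fibreBracket A B).1 K := rfl

theorem bracket_skew (h : IsIntertwiner J F c) (A B : Sections (bundle c c)) :
    h.bracket A B = -h.bracket B A := by
  ext1
  ext1 K
  change (h.bracket A B).1 K = -(h.bracket B A).1 K
  rw [bracket_apply, bracket_apply, fibreBracket_apply, fibreBracket_apply]
  abel

theorem anchor_fibreBracket (h : IsIntertwiner J F c) (A B : Sections (bundle c c))
    (K : Twistor V) :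
    anchor F K ((h.fibreBracket A B).1 K) =
      ⁅⁅F K * A.1 K * F K, F K * B.1 K * F K⁆, (K : V →L[ℝ] V)⁆ := by
  rw [anchor_apply, fibreBracket_apply, Ring.lie_def (F K * A.1 K * F K)]
  congr 1
  noncomm_ring

theorem dAlong_anchor (h : IsIntertwiner J F c) (A B : Sections (bundle c c)) (K : Twistor V) :
    dAlong (fun L => anchor F L (B.1 L)) K (anchor F K (A.1 K)) =
      anchor F K ((h.connection A B).1 K) + ⁅F K * A.1 K * F K, anchor F K (B.1 K)⁆ := by
  rw [connection_apply, ← h.lieDeriv_anchor B.2.1 (h.mul_mul_mem_orth K (A.2.2 K).1)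
    (h.mul_mul_commute (A.2.2 K)), lieDeriv, anchor_apply F K (A.1 K), sub_add_cancel]

theorem anchor_bracket (h : IsIntertwiner J F c) (A B : Sections (bundle c c)) :
    (fun K => anchor F K ((h.bracket A B).1 K)) =
      lieBracket (fun K => anchor F K (A.1 K)) (fun K => anchor F K (B.1 K)) := by
  ext1 K
  have hjacobi (X Y Z : V →L[ℝ] V) : ⁅⁅X, Y⁆, Z⁆ = ⁅X, ⁅Y, Z⁆⁆ - ⁅Y, ⁅X, Z⁆⁆ := by
    simp only [Ring.lie_def]
    noncomm_ring
  rw [lieBracket, h.dAlong_anchor A B, h.dAlong_anchor B A, bracket_apply, map_add, map_sub,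
    anchor_fibreBracket, hjacobi, anchor_apply F K (A.1 K), anchor_apply F K (B.1 K)]
  abel

theorem bracket_leibniz (h : IsIntertwiner J F c) (A B : Sections (bundle c c))
    (f : smoothFun V) : (h.bracket A (f • B)).1 =
      fun K => f.1 K • (h.bracket A B).1 K + dAlong f.1 K (anchor F K (A.1 K)) • B.1 K := by
  ext1 K
  have hleft : (h.connection A (f • B)).1 K =
      f.1 K • (h.connection A B).1 K + dAlong f.1 K (anchor F K (A.1 K)) • B.1 K :=
    lieDeriv_smul f.2 B.2.1 (h.mul_mul_mem_orth K (A.2.2 K).1) K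
  have hright : (h.connection (f • B) A).1 K = f.1 K • (h.connection B A).1 K := by
    change lieDeriv (F K * (f.1 K • B.1 K) * F K) A.1 K = _
    rw [mul_smul_comm, smul_mul_assoc, lieDeriv_smul_left]
    rfl
  have hfibre : (h.fibreBracket A (f • B)).1 K = f.1 K • (h.fibreBracket A B).1 K := by
    change A.1 K * (F K * F K) * (f.1 K • B.1 K) - (f.1 K • B.1 K) * (F K * F K) * A.1 K = _
    rw [mul_smul_comm, smul_mul_assoc, smul_mul_assoc, ← smul_sub]
    rfl
  rw [bracket_apply, bracket_apply, hleft, hright, hfibre]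
  module

theorem isSkewAlgebroid [FiniteDimensional ℝ V] (h : IsIntertwiner J F c) :
    IsSkewAlgebroid (bundle c c) h.bracket (anchor F) where
  isVectorBundle := isVectorBundle_bundle h.right_mem_equivariantEnd.1 h.right_mem_twistorSet
  anchor_mem K _ hA := lie_mem_tangent (h.mul_mul_mem_orth K hA.1) K
  anchor_smooth A := h.isSmooth_anchor A.2.1
  skew := h.bracket_skew
  anchor_bracket := h.anchor_bracket
  leibniz := h.bracket_leibniz

end IsIntertwiner

end Intertwiner

section Bundle

variable {V : Type*} [NormedAddCommGroup V] [InnerProductSpace ℝ V]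

theorem bundleS_eq_bundle (hdim : 4 ≤ finrank ℝ V) (J : Twistor V)
    {S γ δ γ' δ' : Twistor V → (V →L[ℝ] V)} (hS : S ∈ sSet J) (hγ : γ ∈ letters J)
    (hδ : δ ∈ letters J) (hγ' : γ' ∈ letters J) (hδ' : δ' ∈ letters J) (hleft : γ * S = S * γ')
    (hright : S * δ = δ' * S) : bundleS J S γ δ = bundle γ' δ' := by
  ext1 K
  apply le_antisymm
  · exact iInf₂_le_of_le γ' hγ' (iInf₂_le_of_le δ' hδ' (iInf₂_le_of_le hleft hright le_rfl))
  · refine le_iInf₂ fun α hα => le_iInf₂ fun β hβ => le_iInf₂ fun hα' hβ' => ?_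
    rw [(existsUnique_left hdim J hS hγ).unique ⟨hα, hα'⟩ ⟨hγ', hleft⟩,
      (existsUnique_right hdim J hS hδ).unique ⟨hβ, hβ'⟩ ⟨hδ', hright⟩]

theorem mem_twistorSet_of_mem_letters {J : Twistor V} {c : Twistor V → (V →L[ℝ] V)}
    (hc : c ∈ letters J) (K : Twistor V) : c K ∈ twistorSet V := by
  rcases hc with rfl | rfl | rfl | rfl
  exacts [J.2, neg_mem_twistorSet J.2, K.2, neg_mem_twistorSet K.2]

variable [CompleteSpace V]

theorem star_cst (J : Twistor V) : star (cst J) = -cst J :=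
  funext fun _ => star_eq_neg_of_mem_twistorSet J.2

theorem star_φ : star (φ : Twistor V → (V →L[ℝ] V)) = -φ :=
  funext fun K => star_eq_neg_of_mem_twistorSet K.2

theorem star_anti (J : Twistor V) : star (anti J) = anti J := by
  rw [anti, star_add, star_mul, star_mul, star_cst, star_φ, neg_mul_neg, neg_mul_neg, add_comm]

theorem star_polyQ (J : Twistor V) (k : ℕ) (a : ℕ → Twistor V → ℝ) :
    star (polyQ J k a) = polyQ J k a := by
  have hanti (K : Twistor V) : star (anti J K) = anti J K := congr_fun (star_anti J) K
  ext1 K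
  simp only [Pi.star_apply, polyQ, star_sum, star_smul, star_trivial, star_pow, hanti]

theorem star_eq_or_eq_neg_of_mem_sSet {J : Twistor V} {S : Twistor V → (V →L[ℝ] V)}
    (hS : S ∈ sSet J) : star S = S ∨ star S = -S := by
  rcases hS with rfl | rfl | rfl | rfl
  · exact .inl (star_one _)
  · exact .inr (by rw [star_add, star_cst, star_φ, neg_add])
  · exact .inr (by rw [star_sub, star_cst, star_φ]; abel)
  · exact .inr (by rw [star_sub, star_mul, star_mul, star_cst, star_φ]; noncomm_ring)

theorem isIntertwiner_polyQ_mul {J : Twistor V} {S c : Twistor V → (V →L[ℝ] V)} (hS : S ∈ sSet J)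
    (hc : c ∈ letters J) (hleft : cst J * S = S * c) (hright : S * cst J = c * S) {k : ℕ}
    {a : ℕ → Twistor V → ℝ} (ha : ∀ i ≤ k, a i ∈ invariantFun J) :
    IsIntertwiner J (polyQ J k a * S) c where
  mem_equivariantEnd := mul_mem (polyQ_mem_equivariantEnd ha)
    (wordAlgebra_le_equivariantEnd J (sSet_subset_wordAlgebra J hS))
  right_mem_equivariantEnd := wordAlgebra_le_equivariantEnd J (letters_subset_wordAlgebra J hc)
  right_mem_twistorSet := mem_twistorSet_of_mem_letters hc
  cst_mul := by
    rw [← mul_assoc, ← (polyQ_commute_of_mem_wordAlgebra k a (cst_mem_wordAlgebra J)).eq,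
      mul_assoc, hleft, mul_assoc]
  mul_cst := by
    rw [mul_assoc, hright, ← mul_assoc, ← mul_assoc,
      (polyQ_commute_of_mem_wordAlgebra k a (letters_subset_wordAlgebra J hc)).eq]
  star_eq := by
    rw [star_mul, star_polyQ,
      (polyQ_commute_of_mem_wordAlgebra k a (sSet_subset_wordAlgebra J hS)).eq]
    rcases star_eq_or_eq_neg_of_mem_sSet hS with hs | hs <;> rw [hs]
    exacts [.inl rfl, .inr (neg_mul _ _)]

end Bundle

end TwistorSpace

theorem theorem4p3_general {V : Type*} [NormedAddCommGroup V] [InnerProductSpace ℝ V]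
    (hdim : 4 ≤ finrank ℝ V) (J : Twistor V) (S : Twistor V → (V →L[ℝ] V)) (hS : S ∈ sSet J)
    (k : ℕ) (a : ℕ → Twistor V → ℝ) (ha : ∀ i ≤ k, a i ∈ invariantFun J) :
    ∃ br : Sections (bundleS J S (cst J) (cst J)) →ₗ[ℝ]
        Sections (bundleS J S (cst J) (cst J)) →ₗ[ℝ] Sections (bundleS J S (cst J) (cst J)),
      IsSkewAlgebroid (bundleS J S (cst J) (cst J)) br (anchor (polyQ J k a * S)) := by
  have : FiniteDimensional ℝ V := .of_finrank_pos (by omega)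
  have : CompleteSpace V := FiniteDimensional.complete ℝ V
  have hJ : cst J ∈ letters J := .inl rfl
  obtain ⟨c, hc, hleft, hright⟩ := exists_tilde J hS hJ
  rw [bundleS_eq_bundle hdim J hS hJ hJ hc hc hleft hright]
  exact ⟨_, (isIntertwiner_polyQ_mul hS hc hleft hright ha).isSkewAlgebroid⟩

theorem theorem4p3 {V : Type*} [NormedAddCommGroup V] [InnerProductSpace ℝ V]
    [FiniteDimensional ℝ V] (n : ℕ) (hn : 2 ≤ n) (hdim : Module.finrank ℝ V = 2 * n)
    (J : Twistor V)
    (S : Twistor V → (V →L[ℝ] V)) (hS : S ∈ sSet J)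
    (k : ℕ) (a : ℕ → Twistor V → ℝ)
    (ha : ∀ i ≤ k, a i ∈ Algebra.adjoin ℝ (symFun J n '' Set.Icc 1 (2 * n))) :
    ∃ br : Sections (bundleS J S (cst J) (cst J)) →ₗ[ℝ]
        Sections (bundleS J S (cst J) (cst J)) →ₗ[ℝ] Sections (bundleS J S (cst J) (cst J)),
      IsSkewAlgebroid (bundleS J S (cst J) (cst J)) br (anchor (polyQ J k a * S)) := by
  exact theorem4p3_general (by omega) J S hS k a fun i hi =>
    adjoin_symFun_le_invariantFun J n _ (ha i hi)
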